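/- Let $k$ be a commutative ring and $A$ an associative unital $k$-algebra. For $a\in A$ let $L_a\in\mathrm{End}_k(A)$ be left multiplication by $a$, let $L(A)=\{L_a : a\in A\}$, and let $B$ be a $k$-subalgebra with $L(A)\subseteq B\subseteq \mathrm{End}_k(A)$, regarded as a left $A$-module through $a\cdot b=L_a\circ b$. The algebra $A$ is a left $B$-module by evaluation. Suppose that ${}_AB$ is generated by $n$ elements. Let $E$ be an injective hull of ${}_BA$ (an injective left $B$-module containing $A$ as an essential submodule), and let $\hat A=\sum_{f\in\mathrm{Hom}_B(A,E)}\mathrm{Im}(f)\subseteq E$ be the self-injective hull of ${}_BA$. Let $\Delta=\mathrm{End}_B(\hat A)$, where endomorphisms are written, and composed, on the right, so that $\hat A$ is a right $\Delta$-module. Let $\mathrm{udim}(A)\in\mathbb N\cup\{\infty\}$ be the left uniform dimension of $A$, i.e. the supremum of the cardinalities of the index sets of direct sums of nonzero left ideals contained in $A$. Let $A^B=\{a\in A : b(a)=b(1)a \text{ for all } b\in B\}$, a subalgebra of $A$. A left module $M$ is called *monoform* if every nonzero homomorphism $N\to M$ from a submodule $N\subseteq M$ is injective; *compressible* if $M\neq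 0$ and $M$ embeds in each of its nonzero submodules; and *critically compressible* if it is compressible and does not embed in $M/N$ for any nonzero submodule $N\subseteq M$. Suppose that one of the following conditions holds: 1. $A$ is a domain and $A$ is a monoform left $B$-module; or 2. $A$ is a critically compressible left $B$-module; or 3. $A$ is a simple left $B$-module. Then $\Delta$ is a division ring and $$\dim(\hat A_\Delta)\le n\cdot \mathrm{udim}(A),$$ an inequality in $\mathbb N\cup\{\infty\}$ (all infinite dimensions being identified with $\infty$, so that nothing is claimed when $\mathrm{udim}(A)=\infty$). Moreover, in case (2) $A^B$ is a left Ore domain and $\Delta$ is isomorphic, as a ring, to the division ring of (left) fractions of $A^B$; and in case (3) $\hat A=A$. -/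

import Mathlib

universe u v

/-- Uniform (Goldie) dimension of a left module: the supremum, in `ℕ∞`, of the cardinalities of the
independent sets of nonzero submodules (that is, of the index sets of direct sums of nonzero
submodules inside the module). -/
noncomputable def uniformDim (R M : Type*) [Ring R] [AddCommGroup M] [Module R M] : ℕ∞ :=
  ⨆ S ∈ {S : Set (Submodule R M) | ⊥ ∉ S ∧ sSupIndep S}, S.encard

/-- A nonzero module that embeds in each of its nonzero submodules. -/
def IsCompressibleModule (R M : Type*) [Ring R] [AddCommGroup M] [Module R M] : Prop :=
  Nontrivial M ∧ ∀ N : Submodule R M, N ≠ ⊥ → ∃ f : M →ₗ[R] N, Function.Injective f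

/-- A compressible module that does not embed in any of its proper factor modules. -/
def IsCriticallyCompressibleModule (R M : Type*) [Ring R] [AddCommGroup M] [Module R M] : Prop :=
  IsCompressibleModule R M ∧
    ∀ N : Submodule R M, N ≠ ⊥ → ¬ ∃ f : M →ₗ[R] M ⧸ N, Function.Injective f

/-- Every nonzero partial endomorphism is injective. -/
def IsMonoformModule (R M : Type*) [Ring R] [AddCommGroup M] [Module R M] : Prop :=
  ∀ (N : Submodule R M) (f : N →ₗ[R] M), f ≠ 0 → Function.Injective f

/-- `i : M → E` is an injective hull of `M`: an essential embedding in an injective module. -/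
structure IsInjectiveHull {R : Type*} {M E : Type*} [Ring R] [AddCommGroup M] [Module R M]
    [AddCommGroup E] [Module R E] (i : M →ₗ[R] E) : Prop where
  injective_map : Function.Injective i
  injective_module : Module.Injective R E
  essential : ∀ N : Submodule R E, N ≠ ⊥ → N ⊓ LinearMap.range i ≠ ⊥

/-- Every module has an injective hull. -/
theorem exists_isInjectiveHull (R : Type u) (M : Type v) [Ring R] [Small.{v} R]
    [AddCommGroup M] [Module R M] :
    ∃ (E : Type v) (_ : AddCommGroup E) (_ : Module R E) (i : M →ₗ[R] E), IsInjectiveHull i := by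
  obtain ⟨p⟩ := CategoryTheory.EnoughInjectives.presentation (ModuleCat.of R M)
  obtain ⟨J, hJ, f, hf⟩ := p
  have hJi : Module.Injective R J := Module.injective_module_of_injective_object R J
  have hfi : Function.Injective f.hom := (ModuleCat.mono_iff_injective f).1 hf
  set g : M →ₗ[R] J := f.hom with hg
  -- a maximal essential extension of the image of `M` inside `J`
  let P : Set (Submodule R J) := {N | LinearMap.range g ≤ N ∧
    ∀ L : Submodule R J, L ≤ N → L ≠ ⊥ → L ⊓ LinearMap.range g ≠ ⊥}
  obtain ⟨N, hN0, hN⟩ : ∃ N, LinearMap.range g ≤ N ∧ Maximal (· ∈ P) N := by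
    refine zorn_le_nonempty₀ P ?_ (LinearMap.range g)
      ⟨le_rfl, fun L hL h0 => by rwa [inf_eq_left.2 hL]⟩
    intro c hc hchain y hy
    refine ⟨sSup c, ⟨(hc hy).1.trans (le_sSup hy), ?_⟩, fun z hz => le_sSup hz⟩
    intro L hL h0
    obtain ⟨x, hx, hx0⟩ := Submodule.exists_mem_ne_zero_of_ne_bot h0
    obtain ⟨z, hz, hxz⟩ := (Submodule.mem_sSup_of_directed ⟨y, hy⟩ hchain.directedOn).1 (hL hx)
    have h1 : Submodule.span R {x} ≤ z := by simpa [Submodule.span_singleton_le_iff_mem] using hxz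
    have h2 := (hc hz).2 _ h1 (by simpa using hx0)
    refine fun h => h2 (le_bot_iff.1 (h ▸ inf_le_inf_right _ ?_))
    simpa [Submodule.span_singleton_le_iff_mem] using hx
  -- a complement of `N` in `J`
  obtain ⟨K, -, hK⟩ := zorn_le_nonempty₀ {K : Submodule R J | Disjoint K N} (by
    intro c hc hchain y hy
    refine ⟨sSup c, ?_, fun z hz => le_sSup hz⟩
    refine Submodule.disjoint_def.2 ?_
    intro x hx hxN
    obtain ⟨z, hz, hxz⟩ := (Submodule.mem_sSup_of_directed ⟨y, hy⟩ hchain.directedOn).1 hx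
    exact (Submodule.disjoint_def.1 (hc hz)) x hxz hxN) ⊥ disjoint_bot_left
  have hKd : Disjoint K N := hK.prop
  let q : N →ₗ[R] J ⧸ K := K.mkQ ∘ₗ N.subtype
  have hq : Function.Injective q := by
    rw [← LinearMap.ker_eq_bot, LinearMap.ker_eq_bot']
    intro x hx
    have : (x : J) ∈ K := by simpa [q] using hx
    exact Subtype.ext (Submodule.disjoint_def.1 hKd _ this x.2)
  obtain ⟨h, hh⟩ := hJi.out q hq N.subtype
  have hqess : ∀ L : Submodule R (J ⧸ K), L ≠ ⊥ → ∃ x : N, x ≠ 0 ∧ q x ∈ L := by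
    intro L hL
    by_contra! hcon
    apply hL
    have hd : Disjoint (L.comap K.mkQ) N := by
      rw [Submodule.disjoint_def]
      intro x hx hxN
      by_contra hx0
      exact hcon ⟨x, hxN⟩ (by simpa using hx0) (by simpa [q] using hx)
    have hle : L.comap K.mkQ ≤ K := hK.le_of_ge hd (Submodule.le_comap_mkQ K L)
    rw [eq_bot_iff]
    intro y hy
    obtain ⟨x, rfl⟩ := K.mkQ_surjective y
    simpa using hle hy
  have hrange : LinearMap.range h ≤ N := by
    refine hN.le_of_ge ⟨?_, ?_⟩ ?_
    · intro x hx
      exact ⟨q ⟨x, hN0 hx⟩, hh _⟩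
    · intro L hL hL0
      have hLc : L.comap h ≠ ⊥ := by
        obtain ⟨x, hx, hx0⟩ := Submodule.exists_mem_ne_zero_of_ne_bot hL0
        obtain ⟨y, rfl⟩ := hL hx
        exact Submodule.ne_bot_iff _ |>.2 ⟨y, hx, fun h0 => hx0 (by rw [h0, map_zero])⟩
      obtain ⟨x, hx0, hx⟩ := hqess _ hLc
      have hxL : (x : J) ∈ L := by
        have := hh x
        rw [Submodule.mem_comap, this] at hx
        exact hx
      have h2 := hN.prop.2 (L ⊓ N) inf_le_right
        ((Submodule.ne_bot_iff _).2 ⟨x, ⟨hxL, x.2⟩, by simpa using hx0⟩)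
      exact fun h3 => h2 (le_bot_iff.1 (h3 ▸ inf_le_inf_right _ inf_le_left))
    · intro x hx
      exact ⟨q ⟨x, hx⟩, hh _⟩
  let r : J →ₗ[R] N := (h ∘ₗ K.mkQ).codRestrict N fun x => hrange ⟨_, rfl⟩
  have hr : ∀ x : N, r x = x := fun x => Subtype.ext (hh x)
  refine ⟨N, inferInstance, inferInstance, g.codRestrict N fun x => hN0 ⟨x, rfl⟩, ?_, ?_, ?_⟩
  · intro x y hxy
    exact hfi (congrArg Subtype.val hxy)
  · refine ⟨fun X Y _ _ _ _ a ha b => ?_⟩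
    obtain ⟨c, hc⟩ := hJi.out a ha (N.subtype ∘ₗ b)
    exact ⟨r ∘ₗ c, fun x => by
      rw [LinearMap.comp_apply, hc]
      exact hr (b x)⟩
  · intro L hL
    have h1 : L.map N.subtype ≠ ⊥ := by
      intro h0
      refine hL (Submodule.map_injective_of_injective N.injective_subtype ?_)
      rw [h0, Submodule.map_bot]
    have h2 := hN.prop.2 _ (Submodule.map_subtype_le N L) h1
    obtain ⟨x, ⟨⟨y, hy, rfl⟩, m, hm⟩, hx0⟩ := Submodule.exists_mem_ne_zero_of_ne_bot h2
    exact (Submodule.ne_bot_iff _).2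
      ⟨y, ⟨hy, m, Subtype.ext hm⟩, fun h0 => hx0 (by rw [h0, map_zero])⟩

/-- The trace `Tr(X, Y)`: the sum of the images of all homomorphisms `X → Y`. -/
def moduleTrace (R X Y : Type*) [Ring R] [AddCommGroup X] [Module R X]
    [AddCommGroup Y] [Module R Y] : Submodule R Y :=
  ⨆ f : X →ₗ[R] Y, LinearMap.range f

/-- The subalgebra `A^B = {a ∈ A | b · a = (b · 1) a for all b ∈ B}` of `A`, for an algebra
`B` of linear operators on `A` that contains the left multiplications. -/
def operatorInvariants {k A : Type*} [CommRing k] [Ring A] [Algebra k A]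
    (B : Subalgebra k (Module.End k A)) (hB : (Algebra.lmul k A).range ≤ B) : Subalgebra k A where
  carrier := {a | ∀ b ∈ B, b a = b 1 * a}
  mul_mem' := by
    intro x y hx hy b hb
    have h : b * Algebra.lmul k A x ∈ B := B.mul_mem hb (hB ⟨x, rfl⟩)
    have h1 : b (x * y) = b (x * 1) * y := hy _ h
    rw [h1, mul_one, hx b hb, mul_assoc]
  add_mem' := by
    intro x y hx hy b hb
    rw [map_add, hx b hb, hy b hb, mul_add]
  algebraMap_mem' := by
    intro r b hb
    rw [Algebra.algebraMap_eq_smul_one, map_smul, mul_smul_comm, mul_one]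

/-! Write Â for the trace of A in E. A homomorphism from Â to E again has image in Â, so Â inherits
an extension property from E: homomorphisms into Â extend along embeddings into finite powers of Â.
All three hypotheses make A monoform, and they give every nonzero B-submodule of A an element with
zero left annihilator.

Division ring: a monoform module is uniform and essential in Â, so a nonzero endomorphism of Â is
injective, and the extension property supplies a left inverse. A nontrivial ring in which nonzero
elements have left inverses is a division ring.

Dimension: given independent x_1, …, x_s in Â, the extension property yields a density statement,
namely operators c_j that kill every x_i with i ≠ j but not x_j. By essentiality c_j can be chosen
with c_j x_j = w_j in A having zero left annihilator. Expand c_j over the n generators of B, with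
coefficient vector a_j in Aⁿ. A relation ∑ g_j a_j = 0 gives ∑ L(g_j) c_j = 0; applied to x_j this
reads g_j w_j = 0, so g_j = 0. Hence the a_j are independent in Aⁿ, and subadditivity of uniform
dimension gives s ≤ n · udim A.

Fractions: B-endomorphisms of A are right multiplications by invariants. If A is compressible, every
nonzero submodule contains a nonzero invariant. Applied to Ar ∩ As this is the Ore condition;
applied to the elements that an endomorphism of Â sends into A, it produces denominators. -/

/-! ### Uniform dimension of free modules -/

section UniformDimension

variable {R M N ι : Type*} [Ring R] [AddCommGroup M] [Module R M] [AddCommGroup N] [Module R N]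

/-- The elements `x i` with `i ∈ s` are nonzero, and the sum of the cyclic submodules that they
generate is direct. -/
def CyclicIndepOn (R : Type*) {M ι : Type*} [Ring R] [AddCommGroup M] [Module R M]
    (s : Finset ι) (x : ι → M) : Prop :=
  (∀ i ∈ s, x i ≠ 0) ∧ ∀ a : ι → R, ∑ i ∈ s, a i • x i = 0 → ∀ i ∈ s, a i • x i = 0

theorem CyclicIndepOn.card_le_uniformDim {s : Finset ι} {x : ι → M} (h : CyclicIndepOn R s x) :
    (s.card : ℕ∞) ≤ uniformDim R M := by
  classical
  have hind : iSupIndep fun i : s => Submodule.span R {x i} := by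
    rw [iSupIndep_iff_finsetSum_eq_zero_imp_eq_zero]
    intro t y hy hsum i hi
    choose! a ha using fun j hj => Submodule.mem_span_singleton.1 (hy j hj)
    let c : ι → R := fun j => if hj : j ∈ s then if (⟨j, hj⟩ : s) ∈ t then a ⟨j, hj⟩ else 0 else 0
    have hc : ∀ j : s, c j • x j = if j ∈ t then y j else 0 := by
      intro j
      by_cases hj : j ∈ t
      · simp [c, hj, ha j hj]
      · simp [c, hj]
    have h0 := h.2 c (by
      rw [← Finset.sum_coe_sort s fun j => c j • x j]
      simp only [hc, Finset.sum_ite_mem, Finset.univ_inter, hsum]) i i.2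
    rwa [hc, if_pos hi] at h0
  have hne : ∀ i : s, Submodule.span R {x i} ≠ ⊥ := fun i => by simpa using h.1 i i.2
  have hle : (Set.range fun i : s => Submodule.span R {x (i : ι)}).encard ≤ uniformDim R M := by
    refine le_iSup₂_of_le (Set.range fun i : s => Submodule.span R {x (i : ι)})
      ⟨?_, hind.sSupIndep_range⟩ le_rfl
    rintro ⟨i, hi⟩
    exact hne i hi
  -- An independent family of nonzero submodules has no repetitions, so passing to the set of its
  -- members loses nothing.
  rwa [← Set.image_univ, (hind.injective hne).encard_image, Set.encard_univ,
    ENat.card_eq_coe_fintype_card, Fintype.card_coe] at hle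

/-- Bounds for the uniform dimensions of the kernel and the image of a homomorphism add up to a
bound for the uniform dimension of its domain. -/
theorem CyclicIndepOn.card_le_add (f : M →ₗ[R] N) {p q : ℕ}
    (hp : ∀ (s : Finset ι) (y : ι → N), CyclicIndepOn R s y → s.card ≤ p)
    (hq : ∀ (s : Finset ι) (y : ι → M), (∀ i ∈ s, f (y i) = 0) → CyclicIndepOn R s y → s.card ≤ q)
    {s : Finset ι} {x : ι → M} (h : CyclicIndepOn R s x) : s.card ≤ p + q := by
  classical
  -- `P t` says that `f` is injective on the sum of the cyclic submodules indexed by `t`. For a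
  -- largest such `t ⊆ s`, the images of `x i` with `i ∈ t` are independent, and each `j ∈ s \ t`
  -- contributes a nonzero element of the kernel.
  let P : Finset ι → Prop := fun t =>
    ∀ a : ι → R, f (∑ i ∈ t, a i • x i) = 0 → ∑ i ∈ t, a i • x i = 0
  have hsub : ∀ t ⊆ s, ∀ a : ι → R, ∑ i ∈ t, a i • x i = 0 → ∀ i ∈ t, a i • x i = 0 := by
    intro t ht a ha i hi
    have := h.2 (fun i => if i ∈ t then a i else 0)
      (by simpa [ite_smul, Finset.sum_ite_mem, Finset.inter_eq_right.2 ht] using ha) i (ht hi)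
    simpa [hi] using this
  obtain ⟨t, htm, hmax⟩ := (s.powerset.filter P).exists_max_image Finset.card
    ⟨∅, by simp [P]⟩
  obtain ⟨hts, htP⟩ : t ⊆ s ∧ P t := by simpa using htm
  have h1 : t.card ≤ p := by
    refine hp t (fun i => f (x i)) ⟨fun i hi h0 => h.1 i (hts hi) ?_, fun a ha i hi => ?_⟩
    · have := hsub t hts (Pi.single i 1) (htP _ (by simp [Pi.single_apply, ite_smul, hi, h0])) i hi
      simpa using this
    · have := hsub t hts a (htP a (by simpa using ha)) i hi
      rw [← map_smul, this, map_zero]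
  have h2 : ∀ j ∈ s \ t, ∃ a : ι → R, f (∑ i ∈ insert j t, a i • x i) = 0 ∧
      ∑ i ∈ insert j t, a i • x i ≠ 0 := by
    intro j hj
    rw [Finset.mem_sdiff] at hj
    by_contra! hcon
    have := hmax (insert j t) (Finset.mem_filter.2
      ⟨Finset.mem_powerset.2 (Finset.insert_subset hj.1 hts), hcon⟩)
    rw [Finset.card_insert_of_notMem hj.2] at this
    omega
  choose! a ha0 ha using h2
  have h3 : (s \ t).card ≤ q := by
    refine hq (s \ t) (fun j => ∑ i ∈ insert j t, a j i • x i) ha0 ⟨ha, fun c hc j hj => ?_⟩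
    -- Collected in terms of the `x i`, the coefficient at an index `j` outside `t` is `c j * a j j`
    -- alone. It therefore contributes zero, which pushes the `j`-th kernel element times `c j` into
    -- the sum over `t`, where `f` is injective.
    have hexp : ∑ j ∈ s \ t, c j • ∑ i ∈ insert j t, a j i • x i
        = ∑ i ∈ s, (if i ∈ t then ∑ j ∈ s \ t, c j * a j i else c i * a i i) • x i := by
      have e1 : ∑ i ∈ s \ t, (if i ∈ t then ∑ j ∈ s \ t, c j * a j i else c i * a i i) • x i
          = ∑ i ∈ s \ t, (c i * a i i) • x i :=
        Finset.sum_congr rfl fun i hi => by rw [if_neg (Finset.mem_sdiff.1 hi).2]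
      have e2 : ∑ i ∈ t, (if i ∈ t then ∑ j ∈ s \ t, c j * a j i else c i * a i i) • x i
          = ∑ i ∈ t, (∑ j ∈ s \ t, c j * a j i) • x i :=
        Finset.sum_congr rfl fun i hi => by rw [if_pos hi]
      rw [← Finset.sum_sdiff hts, e1, e2]
      simp only [Finset.sum_smul]
      rw [Finset.sum_comm (s := t), ← Finset.sum_add_distrib]
      refine Finset.sum_congr rfl fun j hj => ?_
      rw [Finset.sum_insert (Finset.mem_sdiff.1 hj).2, smul_add, Finset.smul_sum]
      simp only [mul_smul]
    have hj' := Finset.mem_sdiff.1 hj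
    have h4 := h.2 _ (hexp ▸ hc) j hj'.1
    rw [if_neg hj'.2, mul_smul] at h4
    have h5 : c j • ∑ i ∈ insert j t, a j i • x i = ∑ i ∈ t, (c j * a j i) • x i := by
      rw [Finset.sum_insert hj'.2, smul_add, h4, zero_add, Finset.smul_sum]
      simp only [mul_smul]
    show c j • ∑ i ∈ insert j t, a j i • x i = 0
    rw [h5]
    refine htP _ ?_
    rw [← h5, map_smul, ha0 j hj, smul_zero]
  have := Finset.card_sdiff_add_card_eq_card hts
  omega

/-- Induction on `n` by projecting to the first coordinate: the image lies in `R`, and dropping that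
coordinate embeds the kernel in the free module of rank one less. -/
theorem CyclicIndepOn.card_le_mul {q : ℕ}
    (hq : ∀ (s : Finset ι) (y : ι → R), CyclicIndepOn R s y → s.card ≤ q) (n : ℕ) :
    ∀ {s : Finset ι} {x : ι → Fin n → R}, CyclicIndepOn R s x → s.card ≤ n * q := by
  induction n with
  | zero =>
    intro s x h
    rw [Nat.zero_mul, Nat.le_zero, Finset.card_eq_zero, Finset.eq_empty_iff_forall_notMem]
    exact fun i hi => h.1 i hi (Subsingleton.elim _ _)
  | succ n ih =>
    intro s x h
    rw [Nat.succ_mul, add_comm]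
    refine h.card_le_add (LinearMap.proj (0 : Fin (n + 1))) hq fun t y hy h' => ?_
    have htail : ∀ a : ι → R, ∑ i ∈ t, a i • Fin.tail (y i) = Fin.tail (∑ i ∈ t, a i • y i) := by
      intro a
      ext l
      simp [Fin.tail]
    have hzero : ∀ z : Fin (n + 1) → R, z 0 = 0 → Fin.tail z = 0 → z = 0 := by
      intro z h0 h1
      funext l
      refine Fin.cases h0 (fun l => congrFun h1 l) l
    refine ih (x := fun i => Fin.tail (y i)) ⟨fun i hi h0 => h'.1 i hi (hzero _ (hy i hi) h0),
      fun a ha i hi => ?_⟩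
    have hs : ∑ i ∈ t, a i • y i = 0 := by
      refine hzero _ ?_ (by rw [← htail, ha])
      rw [Finset.sum_apply]
      refine Finset.sum_eq_zero fun i hi => ?_
      have : y i 0 = 0 := hy i hi
      simp [this]
    have := h'.2 a hs i hi
    ext l
    simpa [Fin.tail] using congrFun this l.succ

/-- The size of a linearly independent family in `Rⁿ` is at most `n` times the uniform dimension
of `R`. -/
theorem LinearIndependent.card_le_mul_uniformDim [Nontrivial R] [Fintype ι] {n : ℕ} (hn : n ≠ 0)
    {x : ι → Fin n → R} (h : LinearIndependent R x) :
    (Fintype.card ι : ℕ∞) ≤ n * uniformDim R R := by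
  have hx : CyclicIndepOn R Finset.univ x := by
    refine ⟨fun i _ => h.ne_zero i, fun a ha i _ => ?_⟩
    rw [Fintype.linearIndependent_iff.1 h a ha i, zero_smul]
  -- Here `n ≠ 0` matters, since `0 * ⊤ = 0` in `ℕ∞`.
  by_cases hu : uniformDim R R = ⊤
  · rw [hu, ENat.mul_top (by exact_mod_cast hn)]
    exact le_top
  · obtain ⟨q, hq⟩ := ENat.ne_top_iff_exists.1 hu
    have := CyclicIndepOn.card_le_mul (q := q) (fun s y hy => by
      have := hy.card_le_uniformDim
      rw [← hq] at this
      exact_mod_cast this) n hx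
    rw [← hq]
    exact_mod_cast this

end UniformDimension

/-! ### Sufficient conditions for a module to be monoform -/

section Monoform

variable {R M : Type*} [Ring R] [AddCommGroup M] [Module R M]

/-- If a nonzero `f : N → M` had a kernel K ≠ 0, then M would embed in f(N) ≅ N/K ⊆ M/K by
compressibility, which criticality forbids. -/
theorem IsCriticallyCompressibleModule.isMonoformModule
    (h : IsCriticallyCompressibleModule R M) : IsMonoformModule R M := by
  intro N f hf
  rw [← LinearMap.ker_eq_bot]
  by_contra hker
  obtain ⟨g, hg⟩ := h.1.2 (LinearMap.range f) (by rwa [Ne, LinearMap.range_eq_bot])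
  let K : Submodule R M := (LinearMap.ker f).map N.subtype
  have hK : K ≠ ⊥ := fun h0 => hker
    (Submodule.map_injective_of_injective N.injective_subtype (h0.trans (Submodule.map_bot _).symm))
  have hle : LinearMap.ker f = LinearMap.ker (K.mkQ ∘ₗ N.subtype) := by
    rw [LinearMap.ker_comp, Submodule.ker_mkQ, Submodule.comap_map_eq_of_injective
      N.injective_subtype]
  refine h.2 K hK ⟨(LinearMap.ker f).liftQ (K.mkQ ∘ₗ N.subtype) hle.le ∘ₗ
    f.quotKerEquivRange.symm.toLinearMap ∘ₗ g, ?_⟩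
  have h1 : Function.Injective ((LinearMap.ker f).liftQ (K.mkQ ∘ₗ N.subtype) hle.le) := by
    rw [← LinearMap.ker_eq_bot]
    exact Submodule.ker_liftQ_eq_bot _ _ _ hle.ge
  exact h1.comp (f.quotKerEquivRange.symm.injective.comp hg)

theorem IsSimpleModule.isMonoformModule [IsSimpleModule R M] : IsMonoformModule R M := by
  intro N f hf
  rw [← LinearMap.ker_eq_bot]
  have hN : N = ⊤ := by
    refine (eq_bot_or_eq_top N).resolve_left fun h0 => hf ?_
    subst h0
    ext x
    rw [Subsingleton.elim x 0, map_zero, map_zero]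
  subst hN
  have : IsSimpleModule R (⊤ : Submodule R M) := IsSimpleModule.congr Submodule.topEquiv
  refine (eq_bot_or_eq_top _).resolve_right fun h0 => hf ?_
  rwa [LinearMap.ker_eq_top] at h0

end Monoform

/-! ### The self-injective hull and its endomorphism ring -/

section Trace

variable {R M E : Type v} [Ring R] [AddCommGroup M] [Module R M] [AddCommGroup E] [Module R E]

/-- The trace is spanned by images of homomorphisms M → E, and composing one of these with `g` gives
another. This is what lets extensions into E be read as endomorphisms of the trace. -/
theorem map_mem_moduleTrace (g : moduleTrace R M E →ₗ[R] E) (y : moduleTrace R M E) :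
    g y ∈ moduleTrace R M E := by
  obtain ⟨y, hy⟩ := y
  suffices H : moduleTrace R M E ≤ ((moduleTrace R M E).comap g).map (moduleTrace R M E).subtype by
    obtain ⟨z, hz, rfl⟩ := H hy
    exact hz
  refine iSup_le fun f => ?_
  rintro _ ⟨m, rfl⟩
  have hf : ∀ m, f m ∈ moduleTrace R M E := fun m => le_iSup (fun f : M →ₗ[R] E => f.range) f ⟨m, rfl⟩
  refine ⟨⟨f m, hf m⟩, ?_, rfl⟩
  exact le_iSup (fun f : M →ₗ[R] E => f.range) (g ∘ₗ f.codRestrict _ hf) ⟨m, rfl⟩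

/-- Injectivity of E extends `g` to the whole power of the trace; each component of the extension
falls back into the trace by `map_mem_moduleTrace`. -/
theorem exists_end_moduleTrace_pi (hE : Module.Injective R E) {X J : Type v} [AddCommGroup X]
    [Module R X] [Fintype J] (f : X →ₗ[R] J → moduleTrace R M E) (hf : Function.Injective f)
    (g : X →ₗ[R] moduleTrace R M E) :
    ∃ d : J → Module.End R (moduleTrace R M E), ∀ x, ∑ j, d j (f x j) = g x := by
  classical
  obtain ⟨h, hh⟩ := hE.out f hf ((moduleTrace R M E).subtype ∘ₗ g)
  refine ⟨fun j => (h ∘ₗ LinearMap.single R _ j).codRestrict _ (map_mem_moduleTrace _),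
    fun x => Subtype.ext ?_⟩
  have := hh x
  rw [← LinearMap.sum_single_apply _ (f x), map_sum] at this
  simpa using this

theorem exists_end_moduleTrace (hE : Module.Injective R E) {X : Type v} [AddCommGroup X]
    [Module R X] (f : X →ₗ[R] moduleTrace R M E) (hf : Function.Injective f)
    (g : X →ₗ[R] moduleTrace R M E) :
    ∃ d : Module.End R (moduleTrace R M E), ∀ x, d (f x) = g x := by
  obtain ⟨d, hd⟩ := exists_end_moduleTrace_pi hE (J := PUnit) (LinearMap.pi fun _ => f)
    (fun x y hxy => hf (congrFun hxy PUnit.unit)) g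
  exact ⟨d PUnit.unit, fun x => by simpa using hd x⟩

/-- Density: elements of the trace that are independent over its endomorphism ring can be
separated by ring elements. -/
theorem exists_smul_separating (hE : Module.Injective R E) {ι : Type v} [Fintype ι]
    {x : ι → moduleTrace R M E} (hx : LinearIndependent (Module.End R (moduleTrace R M E)) x)
    (hne : Nontrivial (Module.End R (moduleTrace R M E))) (i : ι) :
    ∃ b : R, (∀ j ≠ i, b • x j = 0) ∧ b • x i ≠ 0 := by
  classical
  by_contra! hcon
  let φ : R →ₗ[R] {j // j ≠ i} → moduleTrace R M E :=
    LinearMap.pi fun j => LinearMap.toSpanSingleton R _ (x j)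
  let ψ : R →ₗ[R] moduleTrace R M E := LinearMap.toSpanSingleton R _ (x i)
  -- Without a separating element, `b • x i` depends only on the tuple of the other `b • x j`.
  -- Extending this dependence to endomorphisms and evaluating at `b = 1` writes `x i` as a
  -- combination of the other `x j`.
  have hker : LinearMap.ker φ ≤ LinearMap.ker ψ := by
    intro b hb
    exact hcon b fun j hj => congrFun hb ⟨j, hj⟩
  let e := φ.quotKerEquivRange
  obtain ⟨d, hd⟩ := exists_end_moduleTrace_pi hE (LinearMap.range φ).subtype
    (LinearMap.range φ).injective_subtype
    ((LinearMap.ker φ).liftQ ψ hker ∘ₗ e.symm.toLinearMap)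
  have h1 := hd (e (Submodule.Quotient.mk 1))
  have h2 : ((e (Submodule.Quotient.mk 1) : LinearMap.range φ) : {j // j ≠ i} → _) = φ 1 := rfl
  rw [LinearMap.comp_apply, LinearEquiv.coe_coe, e.symm_apply_apply, Submodule.liftQ_apply,
    Submodule.subtype_apply, h2] at h1
  simp only [φ, ψ, LinearMap.pi_apply, LinearMap.toSpanSingleton_apply, one_smul] at h1
  have h3 := Fintype.linearIndependent_iff.1 hx
    (fun j => if hj : j ≠ i then d ⟨j, hj⟩ else -1) (by
      rw [Fintype.sum_eq_add_sum_subtype_ne _ i]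
      simp only [ne_eq, not_true_eq_false, dite_false, neg_smul, one_smul]
      rw [neg_add_eq_zero, ← h1]
      refine Finset.sum_congr rfl fun j _ => ?_
      rw [dif_pos j.2]
      rfl) i
  simp at h3

variable {i : M →ₗ[R] E}

theorem IsInjectiveHull.exists_mem (h : IsInjectiveHull i) {N : Submodule R E} (hN : N ≠ ⊥) :
    ∃ m : M, m ≠ 0 ∧ i m ∈ N := by
  obtain ⟨_, ⟨hx, m, rfl⟩, hx0⟩ := Submodule.exists_mem_ne_zero_of_ne_bot (h.essential N hN)
  exact ⟨m, fun h0 => hx0 (by rw [h0, map_zero]), hx⟩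

/-- The embedding of a module in the trace of the module in its injective hull. -/
def toModuleTrace (i : M →ₗ[R] E) : M →ₗ[R] moduleTrace R M E :=
  i.codRestrict _ fun m => le_iSup (fun f : M →ₗ[R] E => f.range) i ⟨m, rfl⟩

theorem IsInjectiveHull.toModuleTrace_injective (h : IsInjectiveHull i) :
    Function.Injective (toModuleTrace i) :=
  fun _ _ hxy => h.injective_map (congrArg Subtype.val hxy)

theorem IsInjectiveHull.exists_toModuleTrace_mem (h : IsInjectiveHull i)
    {N : Submodule R (moduleTrace R M E)} (hN : N ≠ ⊥) :
    ∃ m : M, m ≠ 0 ∧ toModuleTrace i m ∈ N := by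
  obtain ⟨m, hm, y, hy, hym⟩ := h.exists_mem (N := N.map (moduleTrace R M E).subtype) fun h0 =>
    hN (Submodule.map_injective_of_injective (Submodule.injective_subtype _)
      (h0.trans (Submodule.map_bot _).symm))
  refine ⟨m, hm, ?_⟩
  rwa [show toModuleTrace i m = y from Subtype.ext hym.symm]

/-- A monoform module is uniform. -/
theorem IsMonoformModule.inf_ne_bot (hM : IsMonoformModule R M) {N K : Submodule R M}
    (hN : N ≠ ⊥) (hK : K ≠ ⊥) : N ⊓ K ≠ ⊥ := by
  intro h0
  have hd : ∀ x y : M, x ∈ N → y ∈ K → x + y = 0 → x = 0 := by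
    intro x y hx hy hxy
    have : x ∈ N ⊓ K := ⟨hx, by rw [eq_neg_of_add_eq_zero_left hxy]; exact K.neg_mem hy⟩
    rwa [h0, Submodule.mem_bot] at this
  let σ : N × K →ₗ[R] M := N.subtype.coprod K.subtype
  have hσ : Function.Injective σ := by
    rw [← LinearMap.ker_eq_bot, LinearMap.ker_eq_bot']
    rintro ⟨x, y⟩ hxy
    have hxy' : (x : M) + y = 0 := by simpa [σ] using hxy
    have hx := hd x y x.2 y.2 hxy'
    rw [hx, zero_add] at hxy'
    exact Prod.ext (Subtype.ext hx) (Subtype.ext hxy')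
  let e := LinearEquiv.ofInjective σ hσ
  obtain ⟨x, hx, hx0⟩ := Submodule.exists_mem_ne_zero_of_ne_bot hN
  obtain ⟨y, hy, hy0⟩ := Submodule.exists_mem_ne_zero_of_ne_bot hK
  -- If N ∩ K = 0, projecting N ⊕ K onto N is a nonzero partial endomorphism that kills K.
  let f : LinearMap.range σ →ₗ[R] M := N.subtype ∘ₗ LinearMap.fst R N K ∘ₗ e.symm.toLinearMap
  have hfe : ∀ z : N × K, f (e z) = z.1 := fun z => by simp [f]
  have hf : Function.Injective f := hM _ f fun h => hx0 (by
    have := hfe (⟨x, hx⟩, 0)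
    rw [h] at this
    exact this.symm)
  have h2 : f (e (0, ⟨y, hy⟩)) = f (e 0) := by rw [hfe, hfe]; rfl
  have := e.injective (hf h2)
  exact hy0 (congrArg (fun z : N × K => (z.2 : M)) this)

/-- On the preimage of M, `f` is a partial endomorphism of M, nonzero because f(M) meets M by
essentiality. It is thus injective there, and the preimage contains the whole kernel of `f`. -/
theorem IsMonoformModule.injective_of_ne_zero (hM : IsMonoformModule R M) (h : IsInjectiveHull i)
    {f : M →ₗ[R] E} (hf : f ≠ 0) : Function.Injective f := by
  let N : Submodule R M := (LinearMap.range i).comap f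
  obtain ⟨m, hm, x, hx⟩ := h.exists_mem (N := LinearMap.range f)
    (by rwa [Ne, LinearMap.range_eq_bot])
  let e := LinearEquiv.ofInjective i h.injective_map
  let g : N →ₗ[R] M := e.symm.toLinearMap ∘ₗ (f ∘ₗ N.subtype).codRestrict _ fun y => y.2
  have hg : ∀ y : N, i (g y) = f y := fun y =>
    congrArg Subtype.val (e.apply_symm_apply ⟨f y, y.2⟩)
  have hginj : Function.Injective g := hM N g fun h0 => hm (h.injective_map (by
    rw [map_zero, ← hx, ← hg ⟨x, m, hx.symm⟩, h0, LinearMap.zero_apply, map_zero]))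
  rw [← LinearMap.ker_eq_bot, LinearMap.ker_eq_bot']
  intro y hy
  have hyN : y ∈ N := ⟨0, by rw [map_zero, hy]⟩
  have : g ⟨y, hyN⟩ = g 0 := h.injective_map (by rw [hg, map_zero, map_zero]; exact hy)
  exact congrArg Subtype.val (hginj this)

/-- As `d ≠ 0`, some `f` from M to the trace has `d ∘ f ≠ 0`, and this composite is injective. If
`ker d` were nonzero, it and the image of `f` would both meet M nontrivially, hence each other by
uniformity, contradicting injectivity of `d ∘ f`. -/
theorem IsMonoformModule.end_injective (hM : IsMonoformModule R M) (h : IsInjectiveHull i)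
    {d : Module.End R (moduleTrace R M E)} (hd : d ≠ 0) : Function.Injective d := by
  rw [← LinearMap.ker_eq_bot]
  by_contra hker
  obtain ⟨f, hf⟩ : ∃ f : M →ₗ[R] moduleTrace R M E, d ∘ₗ f ≠ 0 := by
    by_contra! hcon
    refine hd (LinearMap.ext fun ⟨y, hy⟩ => ?_)
    suffices H : moduleTrace R M E ≤ (LinearMap.ker d).map (moduleTrace R M E).subtype by
      obtain ⟨z, hz, rfl⟩ := H hy
      exact hz
    refine iSup_le fun f => ?_
    rintro _ ⟨m, rfl⟩
    exact ⟨_, LinearMap.congr_fun (hcon (toModuleTrace f)) m, rfl⟩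
  have hdf : Function.Injective (d ∘ₗ f) := by
    have := hM.injective_of_ne_zero h (f := (moduleTrace R M E).subtype ∘ₗ d ∘ₗ f) fun h0 =>
      hf (LinearMap.ext fun m => Subtype.ext (LinearMap.congr_fun h0 m))
    exact Function.Injective.of_comp (f := (moduleTrace R M E).subtype) this
  have hcomap : ∀ K : Submodule R (moduleTrace R M E), K ≠ ⊥ → K.comap (toModuleTrace i) ≠ ⊥ := by
    intro K hK
    obtain ⟨m, hm, hmK⟩ := h.exists_toModuleTrace_mem hK
    exact (Submodule.ne_bot_iff _).2 ⟨m, hmK, hm⟩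
  have hfr : LinearMap.range f ≠ ⊥ := fun h0 => hf (by
    rw [LinearMap.range_eq_bot.1 h0, LinearMap.comp_zero])
  obtain ⟨m, ⟨⟨x, hx⟩, hm2⟩, hm0⟩ := Submodule.exists_mem_ne_zero_of_ne_bot
    (hM.inf_ne_bot (hcomap _ hfr) (hcomap _ hker))
  have hx0 : x = 0 := hdf (by
    rw [map_zero, LinearMap.comp_apply, hx]
    exact hm2)
  refine hm0 (h.toModuleTrace_injective ?_)
  rw [← hx, hx0, map_zero, map_zero]

/-- Extending the identity along the injective map `d` gives a left inverse. That inverse is nonzero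
and has a left inverse of its own, which must be `d`. -/
theorem IsMonoformModule.isUnit_end (hM : IsMonoformModule R M) (h : IsInjectiveHull i)
    {d : Module.End R (moduleTrace R M E)} (hd : d ≠ 0) : IsUnit d := by
  have hleft : ∀ c : Module.End R (moduleTrace R M E), c ≠ 0 → ∃ c', c' * c = 1 := by
    intro c hc
    obtain ⟨c', hc'⟩ := exists_end_moduleTrace h.injective_module c (hM.end_injective h hc)
      LinearMap.id
    exact ⟨c', LinearMap.ext hc'⟩
  obtain ⟨c, hc⟩ := hleft d hd
  have hd0 : ∃ y, d y ≠ 0 := by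
    by_contra! hcon
    exact hd (LinearMap.ext hcon)
  obtain ⟨y, hy⟩ := hd0
  have hne : (1 : Module.End R (moduleTrace R M E)) ≠ 0 := fun h0 =>
    hy (LinearMap.congr_fun h0 (d y))
  obtain ⟨c', hc'⟩ := hleft c fun h0 => hne (by rw [← hc, h0, zero_mul])
  have : c' = d := by rw [← mul_one c', ← hc, ← mul_assoc, hc', one_mul]
  exact ⟨⟨d, c, this ▸ hc', hc⟩, rfl⟩

theorem IsInjectiveHull.nontrivial_end [Nontrivial M] (h : IsInjectiveHull i) :
    Nontrivial (Module.End R (moduleTrace R M E)) := by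
  obtain ⟨m, hm⟩ := exists_ne (0 : M)
  refine ⟨1, 0, fun h0 => hm (h.toModuleTrace_injective ?_)⟩
  rw [map_zero]
  exact LinearMap.congr_fun h0 _

/-- An endomorphism of the trace is determined by its values on the monoform module. -/
theorem IsMonoformModule.end_ext (hM : IsMonoformModule R M) (h : IsInjectiveHull i)
    [Nontrivial M] {c d : Module.End R (moduleTrace R M E)}
    (hcd : ∀ m, c (toModuleTrace i m) = d (toModuleTrace i m)) : c = d := by
  by_contra hne
  obtain ⟨m, hm⟩ := exists_ne (0 : M)
  refine hm (h.toModuleTrace_injective (hM.end_injective h (sub_ne_zero.2 hne) ?_))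
  rw [map_zero, map_zero, LinearMap.sub_apply, hcd, sub_self]

/-- By simplicity the preimage of M under `f : M → E` is zero or everything; if it is zero,
essentiality forces `f = 0`. -/
theorem IsInjectiveHull.moduleTrace_eq_range [IsSimpleModule R M] (h : IsInjectiveHull i) :
    moduleTrace R M E = LinearMap.range i := by
  refine le_antisymm (iSup_le fun f => ?_) (le_iSup (fun f : M →ₗ[R] E => f.range) i)
  rintro _ ⟨x, rfl⟩
  let N : Submodule R M := (LinearMap.range i).comap f
  rcases eq_bot_or_eq_top N with hN | hN
  · by_cases hf : f = 0
    · rw [hf]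
      exact Submodule.zero_mem _
    · obtain ⟨m, hm, y, hy⟩ := h.exists_mem (N := LinearMap.range f)
        (by rwa [Ne, LinearMap.range_eq_bot])
      have hyN : y ∈ N := ⟨m, hy.symm⟩
      rw [hN, Submodule.mem_bot] at hyN
      exact absurd (h.injective_map (by rw [← hy, hyN, map_zero, map_zero])) hm
  · have : x ∈ N := hN ▸ Submodule.mem_top
    exact this

end Trace

/-! ### Operators on A, invariants and the dimension bound -/

section Operators

variable {R A C : Type v} [Ring R] [Ring A] [Module R A] [Ring C]

/-- The ring homomorphism `l` realizes the left multiplications of `A` as actions of `R`. -/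
def IsLeftMul (l : A →+* R) : Prop := ∀ a x : A, l a • x = a * x

/-- The ring homomorphism `j` identifies `C` with the subring of those `a` with
`b • a = (b • 1) * a` for all operators `b`. -/
def IsInvariants (R : Type v) {A C : Type v} [Ring R] [Ring A] [Module R A] [Ring C]
    (j : C →+* A) : Prop :=
  Function.Injective j ∧ ∀ a : A, (∃ c, j c = a) ↔ ∀ b : R, b • a = b • (1 : A) * a

variable {l : A →+* R} {j : C →+* A}

theorem IsLeftMul.map_mul (hl : IsLeftMul l) {X : Type*} [AddCommGroup X] [Module R X]
    (f : A →ₗ[R] X) (a x : A) : f (a * x) = l a • f x := by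
  rw [← map_smul, hl]

theorem IsLeftMul.map_eq (hl : IsLeftMul l) {X : Type*} [AddCommGroup X] [Module R X]
    (f : A →ₗ[R] X) (a : A) : f a = l a • f 1 := by
  rw [← hl.map_mul, mul_one]

theorem IsInvariants.smul_eq (hj : IsInvariants R j) (b : R) (c : C) :
    b • j c = b • (1 : A) * j c := (hj.2 (j c)).1 ⟨c, rfl⟩ b

/-- Since `f` commutes with left multiplications, it is right multiplication by `f 1`, and b · f(1)
= f(b · 1) = (b · 1) f(1). -/
theorem IsInvariants.exists_eq_map_one (hl : IsLeftMul l) (hj : IsInvariants R j)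
    (f : A →ₗ[R] A) : ∃ c, j c = f 1 := by
  refine (hj.2 _).2 fun b => ?_
  rw [← map_smul, hl.map_eq, hl]

/-- Right multiplication by an invariant element commutes with the operators. -/
def rightMul (hl : IsLeftMul l) (hj : IsInvariants R j) (c : C) : A →ₗ[R] A where
  toFun x := x * j c
  map_add' x y := add_mul x y (j c)
  map_smul' b x := by
    -- The operator `b * l x` sends 1 to `b • x`, so invariance at this operator is linearity at
    -- `x`.
    have h := hj.smul_eq (b * l x) c
    rw [mul_smul, mul_smul, hl, hl, mul_one] at h
    exact h.symm

theorem rightMul_apply (hl : IsLeftMul l) (hj : IsInvariants R j) (c : C) (x : A) :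
    rightMul hl hj c x = x * j c := rfl

/-- An embedding of A in N is right multiplication by its value at 1, so that value is the required
invariant, and injectivity makes its left annihilator zero. -/
theorem IsCompressibleModule.exists_invariants_mem (h : IsCompressibleModule R A)
    (hl : IsLeftMul l) (hj : IsInvariants R j) {N : Submodule R A} (hN : N ≠ ⊥) :
    ∃ c : C, c ≠ 0 ∧ j c ∈ N ∧ ∀ a : A, a * j c = 0 → a = 0 := by
  have := h.1
  obtain ⟨f, hf⟩ := h.2 N hN
  obtain ⟨c, hc⟩ := hj.exists_eq_map_one hl (N.subtype ∘ₗ f)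
  have hreg : ∀ a : A, a * j c = 0 → a = 0 := by
    intro a ha
    refine hf (Subtype.ext ?_)
    rw [hl.map_eq, map_zero, Submodule.coe_smul, hl]
    rw [hc] at ha
    exact ha
  refine ⟨c, fun h0 => one_ne_zero (hreg 1 ?_), ?_, hreg⟩
  · rw [h0, map_zero, mul_zero]
  · rw [hc]
    exact (f 1).2

variable {E : Type v} [AddCommGroup E] [Module R E] {i : A →ₗ[R] E}

/-- The dimension bound for `A`, provided that every nonzero submodule of `A` contains an element
with zero left annihilator. -/
theorem rank_moduleTrace_le [Nontrivial A] (hl : IsLeftMul l) {n : ℕ} {b : Fin n → R}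
    (hb : ∀ c : R, ∃ a : Fin n → A, ∑ m, l (a m) * b m = c)
    (h : IsInjectiveHull i)
    (hreg : ∀ N : Submodule R A, N ≠ ⊥ → ∃ w ∈ N, ∀ a : A, a * w = 0 → a = 0) :
    Cardinal.toENat (Module.rank (Module.End R (moduleTrace R A E)) (moduleTrace R A E)) ≤
      n * uniformDim A A := by
  classical
  have hn0 : n ≠ 0 := by
    rintro rfl
    obtain ⟨a, ha⟩ := hb 1
    rw [Fin.sum_univ_zero] at ha
    exact one_ne_zero (by rw [← one_smul R (1 : A), ← ha, zero_smul] : (1 : A) = 0)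
  have hne := h.nontrivial_end
  have key : ∀ s : Finset (moduleTrace R A E),
      LinearIndependent (Module.End R (moduleTrace R A E)) (fun x : s => (x : moduleTrace R A E)) →
      (s.card : ℕ∞) ≤ n * uniformDim A A := by
    intro s hs
    -- A separating operator is multiplied on the left so that its value at `x` becomes an element
    -- of A with zero left annihilator; it still kills the other elements of `s`.
    have hsep : ∀ x : s, ∃ (c : R) (w : A), (∀ y : s, y ≠ x → c • (y : moduleTrace R A E) = 0) ∧
        c • (x : moduleTrace R A E) = toModuleTrace i w ∧ ∀ a : A, a * w = 0 → a = 0 := by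
      intro x
      obtain ⟨c, hc0, hc⟩ := exists_smul_separating h.injective_module hs hne x
      have hN : Submodule.span R {c • (x : moduleTrace R A E)} ≠ ⊥ := by simpa using hc
      obtain ⟨m, hm, hmN⟩ := h.exists_toModuleTrace_mem hN
      obtain ⟨w, hwN, hw⟩ := hreg ((Submodule.span R {c • (x : moduleTrace R A E)}).comap
        (toModuleTrace i)) ((Submodule.ne_bot_iff _).2 ⟨m, hmN, hm⟩)
      obtain ⟨d, hd⟩ := Submodule.mem_span_singleton.1 hwN
      exact ⟨d * c, w, fun y hy => by rw [mul_smul, hc0 y hy, smul_zero],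
        by rw [mul_smul, hd], hw⟩
    choose c w hc0 hcw hw using hsep
    choose a ha using fun x => hb (c x)
    -- A relation among the coefficient vectors is a relation among the operators `c x`; evaluating
    -- it at `y` leaves only `g y * w y = 0`.
    have hlin : LinearIndependent A a := by
      refine Fintype.linearIndependent_iff.2 fun g hg y => hw y _ ?_
      have hsum : ∑ x : s, l (g x) * c x = 0 := by
        have h2 : ∀ m, ∑ x : s, g x * a x m = 0 := fun m => by
          simpa using congrFun hg m
        simp only [← ha, Finset.mul_sum, ← mul_assoc, ← map_mul]
        rw [Finset.sum_comm]
        simp only [← Finset.sum_mul, ← map_sum, h2, map_zero, zero_mul, Finset.sum_const_zero]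
      have h3 := congrArg (fun z : R => z • (y : moduleTrace R A E)) hsum
      simp only [Finset.sum_smul, mul_smul, zero_smul] at h3
      rw [Finset.sum_eq_single y (fun x _ hx => by rw [hc0 x y hx.symm, smul_zero])
        (fun hy => absurd (Finset.mem_univ y) hy), hcw, ← hl.map_mul] at h3
      exact h.toModuleTrace_injective (h3.trans (map_zero _).symm)
    simpa using hlin.card_le_mul_uniformDim hn0
  by_cases hu : n * uniformDim A A = ⊤
  · rw [hu]
    exact le_top
  · obtain ⟨q, hq⟩ := ENat.ne_top_iff_exists.1 hu
    rw [← hq] at key ⊢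
    have := rank_le fun s hs => Nat.cast_le.1 (key s hs)
    simpa using OrderHomClass.mono Cardinal.toENat this

/-! ### The endomorphism ring as a ring of fractions of the invariants -/

section Fractions

variable (hl : IsLeftMul l) (hj : IsInvariants R j)

theorem rightMul_injective (hM : IsMonoformModule R A) (h : IsInjectiveHull i)
    {c : C} (hc : c ≠ 0) : Function.Injective (rightMul hl hj c) := by
  have := hM.injective_of_ne_zero h (f := i ∘ₗ rightMul hl hj c) fun h0 => hc (hj.1
    (h.injective_map (by simpa [rightMul_apply] using LinearMap.congr_fun h0 1)))
  exact Function.Injective.of_comp (f := i) this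

theorem IsInjectiveHull.exists_end_extend (h : IsInjectiveHull i) (f : A →ₗ[R] A) :
    ∃ d : Module.End R (moduleTrace R A E),
      ∀ x, d (toModuleTrace i x) = toModuleTrace i (f x) :=
  exists_end_moduleTrace h.injective_module (toModuleTrace i) h.toModuleTrace_injective
    (toModuleTrace i ∘ₗ f)

/-- The embedding of the ring of invariants in the opposite endomorphism ring of the self-injective
hull, by extension of right multiplications. -/
noncomputable def invariantsToEnd [Nontrivial A] (hM : IsMonoformModule R A)
    (h : IsInjectiveHull i) :
    C →+* (Module.End R (moduleTrace R A E))ᵐᵒᵖ where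
  toFun c := MulOpposite.op (h.exists_end_extend (rightMul hl hj c)).choose
  map_one' := MulOpposite.unop_injective (hM.end_ext h fun x => by
    rw [MulOpposite.unop_op, (h.exists_end_extend _).choose_spec]
    simp [rightMul_apply])
  -- Right multiplication by `c * d` applies `c` first and then `d`, which is the order of
  -- composition in the opposite ring.
  map_mul' c d := MulOpposite.unop_injective (hM.end_ext h fun x => by
    rw [MulOpposite.unop_mul, Module.End.mul_apply, MulOpposite.unop_op, MulOpposite.unop_op,
      MulOpposite.unop_op, (h.exists_end_extend (rightMul hl hj (c * d))).choose_spec,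
      (h.exists_end_extend (rightMul hl hj c)).choose_spec,
      (h.exists_end_extend (rightMul hl hj d)).choose_spec]
    simp [rightMul_apply, mul_assoc])
  map_zero' := MulOpposite.unop_injective (hM.end_ext h fun x => by
    rw [MulOpposite.unop_op, (h.exists_end_extend _).choose_spec]
    simp [rightMul_apply])
  map_add' c d := MulOpposite.unop_injective (hM.end_ext h fun x => by
    rw [MulOpposite.unop_add, LinearMap.add_apply, MulOpposite.unop_op, MulOpposite.unop_op,
      MulOpposite.unop_op, (h.exists_end_extend (rightMul hl hj (c + d))).choose_spec,
      (h.exists_end_extend (rightMul hl hj c)).choose_spec,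
      (h.exists_end_extend (rightMul hl hj d)).choose_spec]
    simp [rightMul_apply, mul_add])

theorem unop_invariantsToEnd_apply [Nontrivial A] (hM : IsMonoformModule R A)
    (h : IsInjectiveHull i) (c : C) (x : A) :
    (invariantsToEnd hl hj hM h c).unop (toModuleTrace i x) = toModuleTrace i (x * j c) :=
  (h.exists_end_extend (rightMul hl hj c)).choose_spec x

theorem invariantsToEnd_injective [Nontrivial A] (hM : IsMonoformModule R A)
    (h : IsInjectiveHull i) : Function.Injective (invariantsToEnd hl hj hM h) := by
  refine (injective_iff_map_eq_zero _).2 fun c hc => hj.1 (h.toModuleTrace_injective ?_)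
  have := unop_invariantsToEnd_apply hl hj hM h c 1
  rw [hc, one_mul] at this
  rw [← this, map_zero, map_zero]
  rfl

theorem isDomain_invariants (hl : IsLeftMul l) (hj : IsInvariants R j) [Nontrivial A] (hM : IsMonoformModule R A)
    (h : IsInjectiveHull i) : IsDomain C := by
  have : Nontrivial C := j.domain_nontrivial
  have : NoZeroDivisors C := by
    refine ⟨fun {c d} hcd => or_iff_not_imp_right.2 fun hd => hj.1 ?_⟩
    refine rightMul_injective hl hj hM h hd ?_
    rw [rightMul_apply, rightMul_apply, ← map_mul, hcd, map_zero, zero_mul]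
  exact NoZeroDivisors.to_isDomain _

theorem isUnit_invariantsToEnd [Nontrivial A] (hM : IsMonoformModule R A)
    (h : IsInjectiveHull i) {c : C} (hc : c ≠ 0) :
    IsUnit (invariantsToEnd hl hj hM h c) := by
  refine (hM.isUnit_end h (d := (invariantsToEnd hl hj hM h c).unop) fun h0 => hc
    (invariantsToEnd_injective hl hj hM h ?_)).op
  rw [map_zero]
  exact MulOpposite.unop_injective h0

/-- The left Ore condition for the ring of invariants of a compressible monoform module. -/
theorem exists_mul_eq_mul (hl : IsLeftMul l) (hj : IsInvariants R j)
    (hC : IsCompressibleModule R A) (hM : IsMonoformModule R A) (h : IsInjectiveHull i) (r : C)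
    {s : C} (hs : s ≠ 0) : ∃ y x : C, x ≠ 0 ∧ x * r = y * s := by
  have := hC.1
  have := j.domain_nontrivial
  by_cases hr : r = 0
  · exact ⟨0, 1, one_ne_zero, by rw [hr, mul_zero, zero_mul]⟩
  have hrange : ∀ c : C, c ≠ 0 → LinearMap.range (rightMul hl hj c) ≠ ⊥ := by
    intro c hc
    exact (Submodule.ne_bot_iff _).2
      ⟨j c, ⟨1, one_mul _⟩, fun h0 => hc (hj.1 (h0.trans (map_zero j).symm))⟩
  -- A left cofactor of one invariant in another is itself invariant: `b • x` and `b • 1 * x` agree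
  -- after right multiplication by `j c`, which is injective.
  have hfactor : ∀ c e : C, c ≠ 0 → ∀ x : A, x * j c = j e → ∃ z, j z = x := by
    intro c e hc x hx
    refine (hj.2 x).2 fun b => rightMul_injective hl hj hM h hc ?_
    rw [map_smul, rightMul_apply, rightMul_apply, hx, mul_assoc, hx, hj.smul_eq]
  obtain ⟨e, he, ⟨⟨x, hx⟩, y, hy⟩, -⟩ := hC.exists_invariants_mem hl hj
    (hM.inf_ne_bot (hrange r hr) (hrange s hs))
  obtain ⟨x, rfl⟩ := hfactor r e hr x hx
  obtain ⟨y, rfl⟩ := hfactor s e hs y hy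
  rw [rightMul_apply, ← map_mul] at hx hy
  have hx' := hj.1 hx
  refine ⟨y, x, fun h0 => he ?_, hx'.trans (hj.1 hy).symm⟩
  rw [← hx', h0, zero_mul]

/-- Every endomorphism of the self-injective hull is a left fraction of invariants. -/
theorem exists_invariantsToEnd_mul_eq [Nontrivial A] (hC : IsCompressibleModule R A)
    (hM : IsMonoformModule R A) (h : IsInjectiveHull i)
    (d : (Module.End R (moduleTrace R A E))ᵐᵒᵖ) :
    ∃ c r : C, c ≠ 0 ∧
      invariantsToEnd hl hj hM h c * d = invariantsToEnd hl hj hM h r := by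
  -- The elements of A that `d` sends into A. An invariant `c` in this submodule serves as
  -- denominator, and its image under `d` as numerator.
  let N : Submodule R A :=
    (LinearMap.range (toModuleTrace i)).comap (d.unop ∘ₗ toModuleTrace i)
  have hN : N ≠ ⊥ := by
    by_cases hd : d.unop = 0
    · refine (Submodule.ne_bot_iff _).2 ⟨1, ⟨0, ?_⟩, one_ne_zero⟩
      rw [hd, map_zero]
      rfl
    · have hinj : Function.Injective (d.unop ∘ₗ toModuleTrace i) :=
        (hM.end_injective h hd).comp h.toModuleTrace_injective
      obtain ⟨m, hm, x, hx⟩ := h.exists_toModuleTrace_mem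
        (N := LinearMap.range (d.unop ∘ₗ toModuleTrace i)) fun h0 => by
          rw [LinearMap.range_eq_bot] at h0
          exact one_ne_zero (hinj (by rw [h0]; rfl) : (1 : A) = 0)
      refine (Submodule.ne_bot_iff _).2 ⟨x, ⟨m, hx.symm⟩, fun h0 => hm ?_⟩
      refine h.toModuleTrace_injective ?_
      rw [← hx, h0, map_zero, map_zero]
  obtain ⟨c, hc, ⟨r, hr⟩, -⟩ := hC.exists_invariants_mem hl hj hN
  rw [LinearMap.comp_apply] at hr
  obtain ⟨r, rfl⟩ : ∃ z, j z = r := by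
    refine (hj.2 r).2 fun b => h.toModuleTrace_injective ?_
    rw [map_smul, hr, ← map_smul, ← map_smul, hj.smul_eq, hl.map_mul, hl.map_mul, map_smul, hr]
  refine ⟨c, r, hc, MulOpposite.unop_injective (hM.end_ext h fun x => ?_)⟩
  rw [MulOpposite.unop_mul, Module.End.mul_apply, unop_invariantsToEnd_apply,
    unop_invariantsToEnd_apply, hl.map_mul, hl.map_mul, map_smul, hr]

/-- Nonzero invariants become units among the endomorphisms, so the embedding extends to the
fractions. The extension is injective because the embedding is, and surjective by
`exists_invariantsToEnd_mul_eq`. -/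
theorem exists_oreSet_ringEquiv (hl : IsLeftMul l) (hj : IsInvariants R j)
    (hC : IsCompressibleModule R A) (hM : IsMonoformModule R A) (h : IsInjectiveHull i) :
    ∃ _ : OreLocalization.OreSet (nonZeroDivisors C),
      Nonempty (OreLocalization (nonZeroDivisors C) C ≃+*
        (Module.End R (moduleTrace R A E))ᵐᵒᵖ) := by
  have := hC.1
  have := isDomain_invariants hl hj hM h
  have hore : ∀ (r : C) (s : nonZeroDivisors C),
      ∃ (y : C) (x : nonZeroDivisors C), (x : C) * r = y * s := by
    intro r s
    obtain ⟨y, x, hx, hxy⟩ := exists_mul_eq_mul hl hj hC hM h r (nonZeroDivisors.ne_zero s.2)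
    exact ⟨y, ⟨x, mem_nonZeroDivisors_of_ne_zero hx⟩, hxy⟩
  choose num den hnd using hore
  let O := OreLocalization.oreSetOfNoZeroDivisors num den hnd
  refine ⟨O, ?_⟩
  have hunit : ∀ s : nonZeroDivisors C,
      IsUnit (((invariantsToEnd hl hj hM h).toMonoidHom.comp (nonZeroDivisors C).subtype) s) :=
    fun s => isUnit_invariantsToEnd hl hj hM h (nonZeroDivisors.ne_zero s.2)
  let F := OreLocalization.universalHom (invariantsToEnd hl hj hM h)
    (IsUnit.liftRight _ hunit) fun s => (IsUnit.coe_liftRight _ hunit s).symm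
  have hF : ∀ r s, F (OreLocalization.oreDiv r s) =
      ((IsUnit.liftRight _ hunit s)⁻¹ : Units _) * invariantsToEnd hl hj hM h r :=
    fun r s => OreLocalization.universalHom_apply _ _ _
  refine ⟨RingEquiv.ofBijective F ⟨?_, fun d => ?_⟩⟩
  · refine (injective_iff_map_eq_zero F).2 fun z => ?_
    induction z using OreLocalization.ind with
    | _ r s =>
      intro hz
      rw [hF, Units.mul_right_eq_zero] at hz
      rw [invariantsToEnd_injective hl hj hM h (hz.trans (map_zero _).symm),
        OreLocalization.zero_oreDiv]
  · obtain ⟨c, r, hc, hcr⟩ := exists_invariantsToEnd_mul_eq hl hj hC hM h d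
    refine ⟨OreLocalization.oreDiv r ⟨c, mem_nonZeroDivisors_of_ne_zero hc⟩, ?_⟩
    rw [hF, Units.inv_mul_eq_iff_eq_mul, IsUnit.coe_liftRight,
      ← hcr]
    rfl

end Fractions

theorem IsSimpleModule.exists_mem_regular [IsSimpleModule R A] (N : Submodule R A) (hN : N ≠ ⊥) :
    ∃ w ∈ N, ∀ a : A, a * w = 0 → a = 0 :=
  ⟨1, (eq_bot_or_eq_top N).resolve_left hN ▸ Submodule.mem_top, fun a ha => by rwa [mul_one] at ha⟩

end Operators

/-- `Module.End` acts and composes on the left, so Δ is its opposite ring and the right dimension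
over Δ is the rank over `Module.End B Ahat`. -/
theorem mainTheorem1 {k : Type u} {A : Type v} [CommRing k] [Ring A] [Algebra k A]
    (B : Subalgebra k (Module.End k A)) (hB : (Algebra.lmul k A).range ≤ B)
    (n : ℕ)
    (hn : ∃ b : Fin n → Module.End k A,
      (Submodule.span A (Set.range b) : Set (Module.End k A)) = (B : Set (Module.End k A)))
    (hA : (IsDomain A ∧ IsMonoformModule B A) ∨ IsCriticallyCompressibleModule B A ∨
      IsSimpleModule B A)
    {E : Type v} [AddCommGroup E] [Module B E] (ι : A →ₗ[B] E) (hι : IsInjectiveHull (R := B) ι) :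
    let Ahat : Submodule B E := moduleTrace B A E
    (Nontrivial (Module.End B Ahat) ∧ ∀ f : Module.End B Ahat, f ≠ 0 → IsUnit f) ∧
    Cardinal.toENat (Module.rank (Module.End B Ahat) Ahat) ≤ n * uniformDim A A ∧
    (IsCriticallyCompressibleModule B A →
      IsDomain (operatorInvariants B hB) ∧
      ∃ _ : OreLocalization.OreSet (nonZeroDivisors (operatorInvariants B hB)),
        Nonempty (OreLocalization (nonZeroDivisors (operatorInvariants B hB))
          (operatorInvariants B hB) ≃+* (Module.End B Ahat)ᵐᵒᵖ)) ∧
    (IsSimpleModule B A → Ahat = LinearMap.range ι) := by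
  intro Ahat
  let l : A →+* B := (Algebra.lmul k A).toRingHom.codRestrict B fun a => hB ⟨a, rfl⟩
  have hl : IsLeftMul (R := B) l := fun a x => rfl
  let j : operatorInvariants B hB →+* A := (operatorInvariants B hB).val.toRingHom
  have hj : IsInvariants B j :=
    ⟨Subtype.val_injective, fun a => ⟨fun ⟨c, hc⟩ b => hc ▸ c.2 b b.2,
      fun ha => ⟨⟨a, fun b hb => ha ⟨b, hb⟩⟩, rfl⟩⟩⟩
  -- The dimension bound and the division ring property use the three cases only through these
  -- consequences.
  obtain ⟨hnt, hM, hreg⟩ : Nontrivial A ∧ IsMonoformModule B A ∧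
      ∀ N : Submodule B A, N ≠ ⊥ → ∃ w ∈ N, ∀ a : A, a * w = 0 → a = 0 := by
    rcases hA with ⟨hD, hM⟩ | hC | hS
    · refine ⟨inferInstance, hM, fun N hN => ?_⟩
      obtain ⟨w, hw, hw0⟩ := Submodule.exists_mem_ne_zero_of_ne_bot hN
      exact ⟨w, hw, fun a ha => (mul_eq_zero.1 ha).resolve_right hw0⟩
    · refine ⟨hC.1.1, hC.isMonoformModule, fun N hN => ?_⟩
      obtain ⟨c, -, hcN, hc⟩ := hC.1.exists_invariants_mem hl hj hN
      exact ⟨j c, hcN, hc⟩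
    · exact ⟨IsSimpleModule.nontrivial B A, IsSimpleModule.isMonoformModule,
        IsSimpleModule.exists_mem_regular (R := B)⟩
  obtain ⟨b, hb⟩ := hn
  have hbB : ∀ m, b m ∈ B := fun m => by
    have : b m ∈ (Submodule.span A (Set.range b) : Set (Module.End k A)) :=
      Submodule.subset_span ⟨m, rfl⟩
    rwa [hb] at this
  have hgen : ∀ c : B, ∃ a : Fin n → A, ∑ m, l (a m) * (⟨b m, hbB m⟩ : B) = c := by
    intro c
    have hc : (c : Module.End k A) ∈ (B : Set (Module.End k A)) := c.2
    rw [← hb] at hc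
    obtain ⟨a, ha⟩ := (Submodule.mem_span_range_iff_exists_fun A).1 hc
    refine ⟨a, Subtype.ext ?_⟩
    rw [← ha, AddSubmonoidClass.coe_finsetSum]
    rfl
  exact ⟨⟨hι.nontrivial_end, fun f hf => hM.isUnit_end hι hf⟩,
    rank_moduleTrace_le hl hgen hι hreg,
    fun hC => ⟨isDomain_invariants hl hj hM hι, exists_oreSet_ringEquiv hl hj hC.1 hM hι⟩,
    fun hS => IsInjectiveHull.moduleTrace_eq_range hι⟩
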